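/- Setting. An episodic Markov decision process (MDP) has a state space $\mathcal S$ with $S$ elements, an action space $\mathcal A$ with $A\ge 2$ elements, a reward function, transition probabilities $P(s'\mid s,a)$, an initial distribution $\mu_0$ and an episode length $H$. Its diameter is $D=\max_{s\in\mathcal S}$ of the minimum length $T$ of a path $s_0,a_0,s_1,a_1,\dots,s_T=s$ with $\mu_0(s_0)>0$ and $P(s_{t+1}\mid s_t,a_t)>0$ for all $t<T$. A learner $L\in\mathcal L$ holds a Q-table $Q_t\in\mathbb R^{\mathcal S\times\mathcal A}$; in state $s$ it plays a greedy action $a^*\in\arg\max_a Q_t(s,a)$ (ties broken by a fixed rule) with probability $1-\epsilon$, and a uniformly random action of $\mathcal A\setminus\{a^*\}$ with probability $\epsilon$; it updates $Q_{t+1}=f(Q_t,(s_t,a_t,r_t,s_{t+1}))$, where $f$ changes only the entry $(s_t,a_t)$ and, for all $Q_t,s_t,a_t,s_{t+1}$, there are rewards $r_t$ that make the rank of $a_t$ in $Q_{t+1}(s_t,\cdot)$ strictly first, strictly last, or unchanged, respectively. A Level 3 teacher knows $f$ and observes the whole history; at the start of each episode of $H$ steps it chooses an initial state with $\mu_0(s_0)>0$,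 and after each action of the learner it chooses an arbitrary reward $r_t\in\mathbb R$ and a next state with $P(s_{t+1}\mid s_t,a_t)>0$. For an initial table $Q_0$ and a target policy $\pi^\dagger:\mathcal S\to\mathcal A$, $\mathrm{METaL}(M,L,Q_0,\pi^\dagger)\in[0,\infty]$ is the infimum over all Level 3 teachers of the expected number $T$ of steps until the greedy policy of the learner equals $\pi^\dagger$ for the first time, and, for a family $\mathcal M$ of MDPs, $\mathrm{TDim}(L,\mathcal M)=\sup_{\pi^\dagger,\,Q_0,\,M\in\mathcal M}\mathrm{METaL}(M,L,Q_0,\pi^\dagger)$. Theorem. There is an absolute constant $c>0$ such that for all finite $\mathcal S$, $\mathcal A$ with $|\mathcal S|=S$ and $|\mathcal A|=A\ge 2$, all $H$ and $D$ with $D\le H$ and $D\le S-2$, and every learner $L\in\mathcal L$ whose exploration probability satisfies $0\le\epsilon\le 1-\frac1A$, the family $\mathcal M$ of all MDPs on $\mathcal S$, $\mathcal A$ with episode length $H$ and diameter $D$ satisfies $$\mathrm{TDim}(L,\mathcal M)\ \ge\ c\,(S-D)\,A\,H\left(\frac1{1-\epsilon}\right)^{D}.$$ -/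

import Mathlib

open scoped ENNReal

noncomputable section

namespace TeachRL

/-- A Q-table. -/
abbrev QTable (𝒮 𝒜 : Type*) := 𝒮 → 𝒜 → ℝ

/-- An experience `(s_t, a_t, r_t, s_{t+1})`. -/
structure Experience (𝒮 𝒜 : Type*) where
  state : 𝒮
  action : 𝒜
  reward : ℝ
  next : 𝒮

/-- An episodic Markov decision process `(𝒮, 𝒜, R, P, μ₀, H)`. -/
structure MDP (𝒮 𝒜 : Type*) where
  /-- reward function -/
  R : 𝒮 → 𝒜 → ℝ
  /-- transition probabilities: `P s a s'` is `P(s' | s, a)` -/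
  P : 𝒮 → 𝒜 → PMF 𝒮
  /-- initial state distribution -/
  μ₀ : PMF 𝒮
  /-- episode length -/
  H : ℕ

/-- `M.ReachIn n s`: the state `s` is the endpoint of a path of length `n` in the directed transition
graph of `M`, starting at some state of positive initial probability. -/
inductive MDP.ReachIn {𝒮 𝒜 : Type*} (M : MDP 𝒮 𝒜) : ℕ → 𝒮 → Prop
  | init (s : 𝒮) (hs : 0 < M.μ₀ s) : M.ReachIn 0 s
  | step (n : ℕ) (s : 𝒮) (a : 𝒜) (s' : 𝒮) (h : M.ReachIn n s) (hs : 0 < M.P s a s') :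
      M.ReachIn (n + 1) s'

/-- The diameter of an MDP: the maximum over all states of the minimum length of a path that reaches
the state (`⊤` if some state cannot be reached). -/
def MDP.diameter {𝒮 𝒜 : Type*} (M : MDP 𝒮 𝒜) : ℕ∞ :=
  ⨆ s : 𝒮, ⨅ (n : ℕ) (_ : M.ReachIn n s), (n : ℕ∞)

/-- The MDPs on given state and action spaces with episode length `H` and diameter `D`. -/
def mdpFamily (𝒮 𝒜 : Type*) (H D : ℕ) : Set (MDP 𝒮 𝒜) :=
  {M | M.H = H ∧ M.diameter = (D : ℕ∞)}

/-- The Q-learning agents: an exploration probability `ε ∈ [0,1]`, a choice of a greedy action (an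
arbitrary element of `argmax_a Q(s, a)`, which only matters in case of ties), and a controllable
update of the Q-table that changes only the entry of the visited state-action pair. -/
structure Learner (𝒮 𝒜 : Type*) where
  ε : ℝ
  ε_nonneg : 0 ≤ ε
  ε_le_one : ε ≤ 1
  greedy : QTable 𝒮 𝒜 → 𝒮 → 𝒜
  greedy_max : ∀ (Q : QTable 𝒮 𝒜) (s : 𝒮) (b : 𝒜), Q s b ≤ Q s (greedy Q s)
  /-- the learning update `Q_{t+1} = f(Q_t, e_t)` -/
  update : QTable 𝒮 𝒜 → Experience 𝒮 𝒜 → QTable 𝒮 𝒜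
  update_local : ∀ (Q : QTable 𝒮 𝒜) (e : Experience 𝒮 𝒜) (s : 𝒮) (a : 𝒜),
    ¬(s = e.state ∧ a = e.action) → update Q e s a = Q s a
  /-- some reward makes `a` the first action of the new ranking at `s` -/
  can_promote : ∀ (Q : QTable 𝒮 𝒜) (s : 𝒮) (a : 𝒜) (s' : 𝒮), ∃ r : ℝ, ∀ b : 𝒜, b ≠ a →
    update Q ⟨s, a, r, s'⟩ s b < update Q ⟨s, a, r, s'⟩ s a
  /-- some reward makes `a` the last action of the new ranking at `s` -/
  can_demote : ∀ (Q : QTable 𝒮 𝒜) (s : 𝒮) (a : 𝒜) (s' : 𝒮), ∃ r : ℝ, ∀ b : 𝒜, b ≠ a →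
    update Q ⟨s, a, r, s'⟩ s a < update Q ⟨s, a, r, s'⟩ s b
  /-- some reward leaves the rank of `a` at `s` unchanged -/
  can_maintain : ∀ (Q : QTable 𝒮 𝒜) (s : 𝒮) (a : 𝒜) (s' : 𝒮), ∃ r : ℝ, ∀ b : 𝒜,
    (update Q ⟨s, a, r, s'⟩ s b < update Q ⟨s, a, r, s'⟩ s a ↔ Q s b < Q s a) ∧
    (update Q ⟨s, a, r, s'⟩ s a < update Q ⟨s, a, r, s'⟩ s b ↔ Q s a < Q s b)

open Classical in
/-- The `ε`-greedy behavior policy: the greedy action with probability `1 - ε`, and otherwise a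
uniformly random one of the other actions. -/
def Learner.behavior {𝒮 𝒜 : Type*} [Fintype 𝒜] [Nontrivial 𝒜] (L : Learner 𝒮 𝒜)
    (Q : QTable 𝒮 𝒜) (s : 𝒮) : PMF 𝒜 :=
  PMF.ofFintype
    (fun a => if a = L.greedy Q s then ENNReal.ofReal (1 - L.ε)
      else ENNReal.ofReal (L.ε / (Fintype.card 𝒜 - 1)))
    (by
      have hA : (1 : ℝ) < Fintype.card 𝒜 := by
        exact_mod_cast Fintype.one_lt_card (α := 𝒜)
      have h0 := L.ε_nonneg
      have h1 := L.ε_le_one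
      have hq : 0 ≤ L.ε / ((Fintype.card 𝒜 : ℝ) - 1) := div_nonneg h0 (by linarith)
      have hf : ∀ a : 𝒜, (if a = L.greedy Q s then ENNReal.ofReal (1 - L.ε)
          else ENNReal.ofReal (L.ε / (Fintype.card 𝒜 - 1))) =
          ENNReal.ofReal (if a = L.greedy Q s then 1 - L.ε
            else L.ε / (Fintype.card 𝒜 - 1)) := by
        intro a
        split_ifs <;> rfl
      simp only [hf]
      rw [← ENNReal.ofReal_sum_of_nonneg]
      · rw [← ENNReal.ofReal_one]
        congr 1
        rw [← Finset.add_sum_erase _ _ (Finset.mem_univ (L.greedy Q s)), if_pos rfl,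
          Finset.sum_congr rfl (fun a ha => if_neg (Finset.ne_of_mem_erase ha)),
          Finset.sum_const, Finset.card_erase_of_mem (Finset.mem_univ _), Finset.card_univ,
          nsmul_eq_mul, Nat.cast_sub (by exact_mod_cast hA.le), Nat.cast_one,
          mul_div_cancel₀ _ (by linarith : ((Fintype.card 𝒜 : ℝ) - 1) ≠ 0)]
        ring
      · intro a _
        split_ifs
        · linarith
        · exact hq)

/-- A history of experiences, the most recent one first; its length is the current time. -/
abbrev History (𝒮 𝒜 : Type*) := List (Experience 𝒮 𝒜)

/-- The Q-table of the learner after a history. -/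
def Learner.table {𝒮 𝒜 : Type*} (L : Learner 𝒮 𝒜) (Q₀ : QTable 𝒮 𝒜) :
    History 𝒮 𝒜 → QTable 𝒮 𝒜
  | [] => Q₀
  | e :: h => L.update (L.table Q₀ h) e

/-- A teacher that observes everything and does not override actions. It may randomize; letting the
MDP draw a state by itself is one of its options. -/
structure Teacher (𝒮 𝒜 : Type*) where
  /-- the initial state of a new episode, after a history -/
  start : History 𝒮 𝒜 → PMF 𝒮
  /-- the reward and the next state, after a history, the current state and the agent's action -/
  respond : History 𝒮 𝒜 → 𝒮 → 𝒜 → PMF (ℝ × 𝒮)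

/-- Level 3: arbitrary rewards, but initial states and next states are supported by the MDP. -/
def Teacher.IsLevelThree {𝒮 𝒜 : Type*} (τ : Teacher 𝒮 𝒜) (M : MDP 𝒮 𝒜) : Prop :=
  (∀ h, ∀ s ∈ (τ.start h).support, 0 < M.μ₀ s) ∧
  (∀ h s a, ∀ x ∈ (τ.respond h s a).support, 0 < M.P s a x.2)

/-- The current state `s_t`: it is reset by the teacher at the times `0, H, 2H, …`, and is otherwise
the last next state. -/
def Teacher.currentState {𝒮 𝒜 : Type*} (τ : Teacher 𝒮 𝒜) (H : ℕ) : History 𝒮 𝒜 → PMF 𝒮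
  | [] => τ.start []
  | e :: h => if (e :: h).length % H = 0 then τ.start (e :: h) else PMF.pure e.next

/-- The law of the history of the first `n` steps of the teaching protocol. -/
def historyLaw {𝒮 𝒜 : Type*} [Fintype 𝒜] [Nontrivial 𝒜] (M : MDP 𝒮 𝒜) (L : Learner 𝒮 𝒜)
    (Q₀ : QTable 𝒮 𝒜) (τ : Teacher 𝒮 𝒜) : ℕ → PMF (History 𝒮 𝒜)
  | 0 => PMF.pure []
  | n + 1 => (historyLaw M L Q₀ τ n).bind fun h =>
      (τ.currentState M.H h).bind fun s =>
        (L.behavior (L.table Q₀ h) s).bind fun a =>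
          (τ.respond h s a).map fun x => (⟨s, a, x.1, x.2⟩ : Experience 𝒮 𝒜) :: h

/-- The learned policy of the learner after a history is the target policy. -/
def Learner.Learned {𝒮 𝒜 : Type*} (L : Learner 𝒮 𝒜) (Q₀ : QTable 𝒮 𝒜) (target : 𝒮 → 𝒜)
    (h : History 𝒮 𝒜) : Prop :=
  ∀ s, L.greedy (L.table Q₀ h) s = target s

/-- The event `T > n`, where `n` is the length of the history `h` and `T` is the first time at which
the learned policy is the target policy: it has not been the target policy at any time up to `n`. -/
def Learner.NotYetLearned {𝒮 𝒜 : Type*} (L : Learner 𝒮 𝒜) (Q₀ : QTable 𝒮 𝒜) (target : 𝒮 → 𝒜)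
    (h : History 𝒮 𝒜) : Prop :=
  ∀ h' : History 𝒮 𝒜, h' <:+ h → ¬ L.Learned Q₀ target h'

/-- The expected teaching length `𝔼 T = ∑ₙ ℙ(T > n)` with values in `[0, ∞]`, where `T` is the first
time at which the learned policy is the target policy. -/
def expectedLength {𝒮 𝒜 : Type*} [Fintype 𝒜] [Nontrivial 𝒜] (M : MDP 𝒮 𝒜) (L : Learner 𝒮 𝒜)
    (Q₀ : QTable 𝒮 𝒜) (target : 𝒮 → 𝒜) (τ : Teacher 𝒮 𝒜) : ℝ≥0∞ :=
  ∑' n : ℕ, (historyLaw M L Q₀ τ n).toOuterMeasure {h | L.NotYetLearned Q₀ target h}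

/-- The minimum expected teaching length (METaL) for Level 3 teachers. -/
def metal {𝒮 𝒜 : Type*} [Fintype 𝒜] [Nontrivial 𝒜] (M : MDP 𝒮 𝒜) (L : Learner 𝒮 𝒜)
    (Q₀ : QTable 𝒮 𝒜) (target : 𝒮 → 𝒜) : ℝ≥0∞ :=
  ⨅ (τ : Teacher 𝒮 𝒜) (_ : τ.IsLevelThree M), expectedLength M L Q₀ target τ

/-- The teaching dimension of a learner with respect to a family of MDPs, for Level 3 teachers. -/
def teachingDim {𝒮 𝒜 : Type*} [Fintype 𝒜] [Nontrivial 𝒜] (L : Learner 𝒮 𝒜)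
    (ℳ : Set (MDP 𝒮 𝒜)) : ℝ≥0∞ :=
  ⨆ (target : 𝒮 → 𝒜) (Q₀ : QTable 𝒮 𝒜) (M : MDP 𝒮 𝒜) (_ : M ∈ ℳ), metal M L Q₀ target

end TeachRL

end

/-!
The lower bound comes from a "peacock tree": a chain of `D` states (the layers `0, …, D - 1`)
followed by a last layer that consists of the other `S - D` states. The target action `a₀` is the same
in all states, and the initial table ranks it strictly last in all of them.

In the first construction only `a₀` advances along the layers. Every other action, and every action in
the last layer, leads to one absorbing state `bin` of the last layer. Since `ε ≤ 1 - 1 / A`, no action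
is ever more likely than the greedy one, so an episode reaches the last layer other than through a
failure with probability at most `(1 - ε) ^ D`, and it then allows a single action there. An update
changes only the entry of the action taken, so to make `a₀` greedy in a state either `a₀` has to be
hit by exploration, which has probability at most `1 / A` per visit, or all its `A - 1` competitors
have to be taken at least once. This takes at least `(A - 1) / 2` visits on average. All in all at
least `(S - D - 1) (A - 1) / 2 * (1 - ε) ^ (-D)` episodes of length `H` are needed, minus one
for the last, incomplete episode (`expectedLength_bin_ge`).

This subtraction is harmful only if `S - D`, `A` and `(1 - ε) ^ (-D)` are all bounded. Then a bound of
order `H` suffices, and it holds if the states of the last layer are absorbing: two such states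
cannot be taught in the same episode (`expectedLength_absorbing_ge`).

Both bounds are instances of a potential argument that handles arbitrary adaptive randomized teachers
(`work_le_expectedLength`): a bounded function of the history that vanishes when the target is
learned, and whose expectation decreases by at most one per step, is at most the expected teaching
length. The potential is `(H / ρ) (W - g)` plus the remaining time of the episode, truncated after
subtracting `H`, where `W` is the work left and `g` bounds the work that can be done in the current
episode, with `g ≤ ρ` at its start.
-/

namespace TeachRL

open Filter

/-! ### Expectations under discrete laws -/

section Expectation

variable {α β : Type*}

/-- The expectation of a `[0, ∞]`-valued function under a discrete law. -/
noncomputable def expect (p : PMF α) (F : α → ℝ≥0∞) : ℝ≥0∞ := ∑' a, p a * F a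

lemma expect_pure (a : α) (F : α → ℝ≥0∞) : expect (PMF.pure a) F = F a := by
  classical
  unfold expect
  rw [tsum_eq_single a]
  · simp
  · intro b hb
    simp [PMF.pure_apply, hb]

lemma expect_bind (p : PMF α) (f : α → PMF β) (F : β → ℝ≥0∞) :
    expect (p.bind f) F = expect p fun a => expect (f a) F := by
  unfold expect
  simp_rw [PMF.bind_apply, ← ENNReal.tsum_mul_right, ← ENNReal.tsum_mul_left]
  rw [ENNReal.tsum_comm]
  simp_rw [mul_assoc]

lemma expect_map (p : PMF α) (f : α → β) (F : β → ℝ≥0∞) :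
    expect (p.map f) F = expect p fun a => F (f a) := by
  rw [PMF.map, expect_bind]
  simp_rw [Function.comp_apply, expect_pure]

lemma expect_mono {p : PMF α} {F G : α → ℝ≥0∞} (h : ∀ a ∈ p.support, F a ≤ G a) :
    expect p F ≤ expect p G := by
  refine ENNReal.tsum_le_tsum fun a => ?_
  by_cases ha : p a = 0
  · simp [ha]
  · exact mul_le_mul_right (h a ((PMF.mem_support_iff _ _).2 ha)) _

lemma expect_const (p : PMF α) (c : ℝ≥0∞) : expect p (fun _ => c) = c := by
  unfold expect
  rw [ENNReal.tsum_mul_right, PMF.tsum_coe, one_mul]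

lemma expect_add (p : PMF α) (F G : α → ℝ≥0∞) :
    expect p (fun a => F a + G a) = expect p F + expect p G := by
  unfold expect
  simp_rw [mul_add]
  exact ENNReal.tsum_add

lemma expect_indicator (p : PMF α) (s : Set α) :
    expect p (s.indicator fun _ => 1) = p.toOuterMeasure s := by
  classical
  rw [PMF.toOuterMeasure_apply]
  refine tsum_congr fun a => ?_
  by_cases ha : a ∈ s <;> simp [ha]

lemma le_expect {p : PMF α} {c : ℝ≥0∞} {F : α → ℝ≥0∞} (h : ∀ a ∈ p.support, c ≤ F a) :
    c ≤ expect p F :=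
  (expect_const p c).symm.le.trans (expect_mono h)

/-- Truncation at zero can only increase a finite expectation. -/
lemma ofReal_sum_le_expect [Fintype α] (p : PMF α) (m : α → ℝ) :
    ENNReal.ofReal (∑ a, (p a).toReal * m a) ≤ expect p fun a => ENNReal.ofReal (m a) := by
  unfold expect
  rw [tsum_fintype]
  have h : ∀ a, p a * ENNReal.ofReal (m a) = ENNReal.ofReal ((p a).toReal * max (m a) 0) := by
    intro a
    rw [ENNReal.ofReal_mul ENNReal.toReal_nonneg, ENNReal.ofReal_toReal (p.apply_ne_top a)]
    rcases le_total (m a) 0 with h | h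
    · simp [h, ENNReal.ofReal_of_nonpos h]
    · simp [h]
  simp_rw [h]
  rw [← ENNReal.ofReal_sum_of_nonneg
    fun a _ => mul_nonneg ENNReal.toReal_nonneg (le_max_right _ _)]
  exact ENNReal.ofReal_le_ofReal (Finset.sum_le_sum fun a _ =>
    mul_le_mul_of_nonneg_left (le_max_left _ _) ENNReal.toReal_nonneg)

lemma sum_toReal_eq_one [Fintype α] (p : PMF α) : ∑ a, (p a).toReal = 1 := by
  rw [← ENNReal.toReal_sum fun a _ => p.apply_ne_top a, ← tsum_fintype (L := .unconditional _),
    PMF.tsum_coe, ENNReal.toReal_one]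

end Expectation

/-! ### Behavior and Q-table of the learner -/

section Learner

variable {𝒮 𝒜 : Type*}

/-- The action `a` has been taken in the state `s` at some time of the history `h`. -/
def Tried (h : History 𝒮 𝒜) (s : 𝒮) (a : 𝒜) : Prop := ∃ e ∈ h, e.state = s ∧ e.action = a

lemma tried_cons {e : Experience 𝒮 𝒜} {h : History 𝒮 𝒜} {s : 𝒮} {a : 𝒜} :
    Tried (e :: h) s a ↔ (e.state = s ∧ e.action = a) ∨ Tried h s a := by
  simp [Tried]

lemma not_tried_nil {s : 𝒮} {a : 𝒜} : ¬ Tried ([] : History 𝒮 𝒜) s a := by simp [Tried]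

lemma Learner.table_eq_of_not_tried (L : Learner 𝒮 𝒜) (Q₀ : QTable 𝒮 𝒜) {s : 𝒮} {a : 𝒜} :
    ∀ h : History 𝒮 𝒜, ¬ Tried h s a → L.table Q₀ h s a = Q₀ s a
  | [], _ => rfl
  | e :: h, hn => by
    rw [tried_cons, not_or] at hn
    rw [Learner.table, L.update_local _ _ _ _ fun hh => hn.1 ⟨hh.1.symm, hh.2.symm⟩]
    exact L.table_eq_of_not_tried Q₀ h hn.2

open Classical in
/-- The Q-table that ranks the action `a₀` strictly last in every state. -/
noncomputable def lastTable (𝒮 : Type*) {𝒜 : Type*} (a₀ : 𝒜) : QTable 𝒮 𝒜 := fun _ a => if a = a₀ then 0 else 1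

/-- As long as neither `a₀` nor some competitor `b` has been taken in `s`, the competitor keeps its
place above `a₀`, so `a₀` is not greedy. -/
lemma Learner.greedy_ne_of_not_tried (L : Learner 𝒮 𝒜) {a₀ b : 𝒜} (hb : b ≠ a₀) {s : 𝒮}
    {h : History 𝒮 𝒜} (h₀ : ¬ Tried h s a₀) (h₁ : ¬ Tried h s b) :
    L.greedy (L.table (lastTable 𝒮 a₀) h) s ≠ a₀ := by
  intro hg
  have := L.greedy_max (L.table (lastTable 𝒮 a₀) h) s b
  rw [hg, L.table_eq_of_not_tried _ h h₀, L.table_eq_of_not_tried _ h h₁] at this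
  simp [lastTable, hb] at this
  linarith

lemma notYetLearned_of_cons {L : Learner 𝒮 𝒜} {Q₀ : QTable 𝒮 𝒜} {target : 𝒮 → 𝒜}
    {e : Experience 𝒮 𝒜} {h : History 𝒮 𝒜} (hh : L.NotYetLearned Q₀ target h)
    (hn : ¬ L.Learned Q₀ target (e :: h)) : L.NotYetLearned Q₀ target (e :: h) := by
  intro h' hs
  rcases List.suffix_cons_iff.1 hs with rfl | hs
  · exact hn
  · exact hh h' hs

variable [Fintype 𝒜] [Nontrivial 𝒜]

lemma one_lt_card_real (𝒜 : Type*) [Fintype 𝒜] [Nontrivial 𝒜] : (1 : ℝ) < Fintype.card 𝒜 := by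
  exact_mod_cast Fintype.one_lt_card (α := 𝒜)

lemma Learner.exploration_le (L : Learner 𝒮 𝒜) (hε : L.ε ≤ 1 - 1 / (Fintype.card 𝒜 : ℝ)) :
    L.ε / ((Fintype.card 𝒜 : ℝ) - 1) ≤ 1 / (Fintype.card 𝒜 : ℝ) := by
  have hA := one_lt_card_real 𝒜
  rw [div_le_iff₀ (by linarith)]
  refine hε.trans (le_of_eq ?_)
  field_simp

lemma Learner.behavior_toReal_of_ne (L : Learner 𝒮 𝒜) (Q : QTable 𝒮 𝒜) {s : 𝒮} {a : 𝒜}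
    (ha : L.greedy Q s ≠ a) :
    (L.behavior Q s a).toReal = L.ε / ((Fintype.card 𝒜 : ℝ) - 1) := by
  have hA := one_lt_card_real 𝒜
  rw [Learner.behavior, PMF.ofFintype_apply, if_neg ha.symm,
    ENNReal.toReal_ofReal (div_nonneg L.ε_nonneg (by linarith))]

/-- If `ε ≤ 1 - 1 / A`, no action is more likely than the greedy one. -/
lemma Learner.behavior_toReal_le (L : Learner 𝒮 𝒜) (hε : L.ε ≤ 1 - 1 / (Fintype.card 𝒜 : ℝ))
    (Q : QTable 𝒮 𝒜) (s : 𝒮) (a : 𝒜) : (L.behavior Q s a).toReal ≤ 1 - L.ε := by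
  by_cases ha : L.greedy Q s = a
  · rw [Learner.behavior, PMF.ofFintype_apply, if_pos ha.symm,
      ENNReal.toReal_ofReal (by linarith [L.ε_le_one])]
  · rw [L.behavior_toReal_of_ne Q ha]
    linarith [L.exploration_le hε]

end Learner

/-! ### A potential argument for lower bounds on the teaching length -/

section Potential

variable {𝒮 𝒜 : Type*} [Fintype 𝒜] [Nontrivial 𝒜]

/-- The law of the history one step after the history `h`. -/
noncomputable def stepLaw (M : MDP 𝒮 𝒜) (L : Learner 𝒮 𝒜) (Q₀ : QTable 𝒮 𝒜) (τ : Teacher 𝒮 𝒜)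
    (h : History 𝒮 𝒜) : PMF (History 𝒮 𝒜) :=
  (τ.currentState M.H h).bind fun s =>
    (L.behavior (L.table Q₀ h) s).bind fun a =>
      (τ.respond h s a).map fun x => (⟨s, a, x.1, x.2⟩ : Experience 𝒮 𝒜) :: h

lemma exists_cons_of_mem_support_stepLaw {M : MDP 𝒮 𝒜} {L : Learner 𝒮 𝒜} {Q₀ : QTable 𝒮 𝒜}
    {τ : Teacher 𝒮 𝒜} {h h' : History 𝒮 𝒜} (hh : h' ∈ (stepLaw M L Q₀ τ h).support) :
    ∃ e, h' = e :: h := by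
  simp only [stepLaw, PMF.mem_support_bind_iff, PMF.mem_support_map_iff] at hh
  obtain ⟨s, _, a, _, x, _, rfl⟩ := hh
  exact ⟨_, rfl⟩

/-- A bounded potential that vanishes once the target is learned and decreases by at most one per
step in expectation is a lower bound on the expected teaching length. -/
lemma potential_le_expectedLength {M : MDP 𝒮 𝒜} {L : Learner 𝒮 𝒜} {Q₀ : QTable 𝒮 𝒜}
    {target : 𝒮 → 𝒜} {τ : Teacher 𝒮 𝒜} (Φ : History 𝒮 𝒜 → ℝ≥0∞) {B : ℝ≥0∞} (hB : B ≠ ⊤)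
    (hΦB : ∀ h, Φ h ≤ B) (hΦ0 : ∀ h, L.Learned Q₀ target h → Φ h = 0)
    (hstep : ∀ h, Φ h ≤ 1 + expect (stepLaw M L Q₀ τ h) Φ) :
    Φ [] ≤ expectedLength M L Q₀ target τ := by
  set N : Set (History 𝒮 𝒜) := {h | L.NotYetLearned Q₀ target h} with hN
  set p : ℕ → ℝ≥0∞ := fun n => (historyLaw M L Q₀ τ n).toOuterMeasure N with hp
  set J : ℕ → ℝ≥0∞ := fun n => expect (historyLaw M L Q₀ τ n) (N.indicator Φ) with hJ
  have hJ0 : Φ [] ≤ J 0 := by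
    simp only [hJ, historyLaw, expect_pure]
    by_cases h : ([] : History 𝒮 𝒜) ∈ N
    · rw [Set.indicator_of_mem h]
    · have hl : L.Learned Q₀ target [] := by
        by_contra hl
        refine h fun h' hs => ?_
        rw [List.suffix_nil.1 hs]
        exact hl
      rw [hΦ0 _ hl]
      exact zero_le
  have hJs : ∀ n, J n ≤ p n + J (n + 1) := by
    intro n
    have h1 : J (n + 1) = expect (historyLaw M L Q₀ τ n)
        fun h => expect (stepLaw M L Q₀ τ h) (N.indicator Φ) := by
      simp only [hJ]
      rw [← expect_bind]
      rfl
    rw [h1, hp]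
    simp only
    rw [← expect_indicator, ← expect_add]
    refine expect_mono fun h _ => ?_
    by_cases hh : h ∈ N
    · rw [Set.indicator_of_mem hh, Set.indicator_of_mem hh]
      refine (hstep h).trans (add_le_add_right (expect_mono fun h' hh' => ?_) 1)
      obtain ⟨e, rfl⟩ := exists_cons_of_mem_support_stepLaw hh'
      by_cases hl : L.Learned Q₀ target (e :: h)
      · rw [hΦ0 _ hl]
        exact zero_le
      · rw [Set.indicator_of_mem (show e :: h ∈ N from notYetLearned_of_cons hh hl)]
    · rw [Set.indicator_of_notMem hh]
      exact zero_le
  have hsum : ∀ n, Φ [] ≤ ∑ k ∈ Finset.range n, p k + J n := by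
    intro n
    induction n with
    | zero => simpa using hJ0
    | succ n ih =>
      rw [Finset.sum_range_succ, add_assoc]
      exact ih.trans (add_le_add_right (hJs n) _)
  have hJB : ∀ n, J n ≤ p n * B := by
    intro n
    simp only [hJ, hp]
    rw [← expect_indicator]
    unfold expect
    rw [← ENNReal.tsum_mul_right]
    refine ENNReal.tsum_le_tsum fun h => ?_
    by_cases hh : h ∈ N
    · rw [Set.indicator_of_mem hh, Set.indicator_of_mem hh, mul_one]
      exact mul_le_mul_right (hΦB h) _
    · simp [hh]
  change Φ [] ≤ ∑' n, p n
  by_cases htop : ∑' n, p n = ⊤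
  · rw [htop]
    exact le_top
  have hlim : Tendsto (fun n => ∑' k, p k + p n * B) atTop (nhds (∑' k, p k + 0 * B)) :=
    tendsto_const_nhds.add
      (ENNReal.Tendsto.mul_const (ENNReal.tendsto_atTop_zero_of_tsum_ne_top htop) (Or.inr hB))
  rw [zero_mul, add_zero] at hlim
  refine ge_of_tendsto' hlim fun n => (hsum n).trans ?_
  exact add_le_add (ENNReal.sum_le_tsum _) (hJB n)

/-- Suppose that `W` measures the work left to do, and that `g` bounds the expected work that can
still be done in the current episode: in expectation `W - g` does not decrease, whatever the teacher
does. If `g` is at most `ρ` at the start of each episode, then every unit of work costs `H / ρ` steps,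
except for the last, incomplete episode. The function `m` bounds `W - g` after each action of the
learner, uniformly over the responses of the teacher. -/
lemma work_le_expectedLength {M : MDP 𝒮 𝒜} {L : Learner 𝒮 𝒜} {Q₀ : QTable 𝒮 𝒜}
    {target : 𝒮 → 𝒜} {τ : Teacher 𝒮 𝒜} (hτ : τ.IsLevelThree M) (hH : 0 < M.H)
    (W : History 𝒮 𝒜 → ℝ) (g : History 𝒮 𝒜 → 𝒮 → ℝ) {C ρ : ℝ} (hρ : 0 < ρ)
    (hWC : ∀ h, W h ≤ C) (hW0 : ∀ h, L.Learned Q₀ target h → W h = 0)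
    (hg : ∀ h s, 0 ≤ g h s) (hgρ : ∀ h s, 0 < M.μ₀ s → g h s ≤ ρ)
    (hdrift : ∀ h s, ∃ m : 𝒜 → ℝ,
      (∀ a r s', 0 < M.P s a s' → m a ≤ W (⟨s, a, r, s'⟩ :: h) - g (⟨s, a, r, s'⟩ :: h) s') ∧
      W h - g h s ≤ ∑ a, (L.behavior (L.table Q₀ h) s a).toReal * m a) :
    ENNReal.ofReal (M.H / ρ * W [] - M.H) ≤ expectedLength M L Q₀ target τ := by
  set K : ℝ := M.H / ρ with hK
  have hK0 : 0 ≤ K := by positivity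
  have hKρ : K * ρ = M.H := by
    rw [hK]
    field_simp
  -- `Ψ h s` is the potential once the current state is known, with the remaining time of the
  -- episode; at an episode start it is at least `K * W h`, because `K * ρ = H`.
  set Ψ : History 𝒮 𝒜 → 𝒮 → ℝ :=
    fun h s => K * (W h - g h s) + (M.H - (h.length % M.H : ℕ)) with hΨ
  set φ : History 𝒮 𝒜 → ℝ := fun h => match h with
    | [] => K * W []
    | e :: h => if (e :: h).length % M.H = 0 then K * W (e :: h) else Ψ (e :: h) e.next with hφ
  have hstart : ∀ h s, h.length % M.H = 0 → 0 < M.μ₀ s → K * W h ≤ Ψ h s := by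
    intro h s h0 hs
    simp only [hΨ, h0, Nat.cast_zero, sub_zero]
    nlinarith [mul_le_mul_of_nonneg_left (hgρ h s hs) hK0]
  have hcur : ∀ h, ∀ s ∈ (τ.currentState M.H h).support, φ h ≤ Ψ h s := by
    intro h s hs
    cases h with
    | nil => exact hstart [] s (by simp) (hτ.1 _ _ hs)
    | cons e h =>
      simp only [hφ]
      simp only [Teacher.currentState] at hs
      split_ifs with h0
      · rw [if_pos h0] at hs
        exact hstart _ _ h0 (hτ.1 _ _ hs)
      · rw [if_neg h0, PMF.support_pure, Set.mem_singleton_iff] at hs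
        rw [hs]
  have hnext : ∀ h e, K * (W (e :: h) - g (e :: h) e.next) + (M.H - (h.length % M.H : ℕ) - 1)
      ≤ φ (e :: h) := by
    intro h e
    have hlt : h.length % M.H < M.H := Nat.mod_lt _ hH
    have hmod : (e :: h).length % M.H = (h.length % M.H + 1) % M.H := by
      rw [List.length_cons, Nat.mod_add_mod]
    simp only [hφ]
    rcases Nat.lt_or_ge (h.length % M.H + 1) M.H with h1 | h1
    · rw [Nat.mod_eq_of_lt h1] at hmod
      rw [if_neg (by omega)]
      simp only [hΨ, hmod]
      push_cast
      linarith
    · have h2 : h.length % M.H + 1 = M.H := by omega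
      rw [if_pos (by rw [hmod, h2, Nat.mod_self])]
      have h3 : ((h.length % M.H : ℕ) : ℝ) + 1 = M.H := by exact_mod_cast h2
      nlinarith [mul_nonneg hK0 (hg (e :: h) e.next)]
  have hφW : ∀ h, φ h - M.H ≤ K * W h := by
    intro h
    have hH0 : (0 : ℝ) ≤ M.H := Nat.cast_nonneg _
    cases h with
    | nil =>
      simp only [hφ]
      linarith
    | cons e h =>
      simp only [hφ]
      split_ifs
      · linarith
      · have : (0 : ℝ) ≤ ((e :: h).length % M.H : ℕ) := Nat.cast_nonneg _
        simp only [hΨ]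
        nlinarith [mul_nonneg hK0 (hg (e :: h) e.next)]
  refine potential_le_expectedLength (Φ := fun h => ENNReal.ofReal (φ h - M.H))
    (B := ENNReal.ofReal (K * C)) ENNReal.ofReal_ne_top ?_ ?_ ?_
  · intro h
    exact ENNReal.ofReal_le_ofReal ((hφW h).trans (mul_le_mul_of_nonneg_left (hWC h) hK0))
  · intro h hl
    refine ENNReal.ofReal_of_nonpos ((hφW h).trans ?_)
    rw [hW0 h hl, mul_zero]
  · intro h
    rw [stepLaw, expect_bind, ← expect_const (τ.currentState M.H h) 1, ← expect_add]
    refine le_expect fun s hs => ?_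
    obtain ⟨m, hm, hsum⟩ := hdrift h s
    set t : ℝ := ((h.length % M.H : ℕ) : ℝ) with ht
    set q : 𝒜 → ℝ := fun a => (L.behavior (L.table Q₀ h) s a).toReal with hq
    have hlow : ENNReal.ofReal (∑ a, q a * (K * m a + (M.H - t - 1) - M.H)) ≤
        expect (L.behavior (L.table Q₀ h) s) fun a =>
          expect ((τ.respond h s a).map fun x => (⟨s, a, x.1, x.2⟩ : Experience 𝒮 𝒜) :: h)
            fun h => ENNReal.ofReal (φ h - M.H) := by
      refine (ofReal_sum_le_expect _ _).trans (expect_mono fun a _ => ?_)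
      rw [expect_map]
      refine le_expect fun x hx => ENNReal.ofReal_le_ofReal ?_
      have h1 := hm a x.1 x.2 (hτ.2 h s a x hx)
      have h2 := hnext h ⟨s, a, x.1, x.2⟩
      have h3 := mul_le_mul_of_nonneg_left h1 hK0
      simp only at h2
      linarith
    rw [expect_bind]
    refine le_trans ?_ (add_le_add_right hlow 1)
    rw [← ENNReal.ofReal_one]
    refine le_trans (ENNReal.ofReal_le_ofReal ?_) ENNReal.ofReal_add_le
    have hsplit : ∑ a, q a * (K * m a + (M.H - t - 1) - M.H) =
        K * ∑ a, q a * m a + (M.H - t - 1 - M.H) := by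
      have : ∀ a, q a * (K * m a + (M.H - t - 1) - M.H) =
          K * (q a * m a) + q a * (M.H - t - 1 - M.H) := fun a => by ring
      simp_rw [this]
      rw [Finset.sum_add_distrib, ← Finset.mul_sum, ← Finset.sum_mul, sum_toReal_eq_one, one_mul]
    rw [hsplit]
    have h1 := hcur h s hs
    have h2 := mul_le_mul_of_nonneg_left hsum hK0
    simp only [hΨ] at h1
    linarith

end Potential

/-! ### Layered Markov decision processes -/

section Layered

variable {𝒮 𝒜 : Type*} [Fintype 𝒮]

/-- A chain of `D` states followed by a last layer that consists of all the other states. -/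
lemma exists_layer {D : ℕ} (hS : D < Fintype.card 𝒮) : ∃ layer : 𝒮 → ℕ,
    (∀ s, layer s ≤ D) ∧ (∀ k ≤ D, ∃ s, layer s = k) ∧
      (Finset.univ.filter fun s => layer s = D).card = Fintype.card 𝒮 - D := by
  classical
  let e := Fintype.equivFin 𝒮
  refine ⟨fun s => min (e s) D, fun s => min_le_right _ _, fun k hk => ?_, ?_⟩
  · refine ⟨e.symm ⟨k, by omega⟩, ?_⟩
    simp [hk]
  · have h1 : (Finset.univ.filter fun s => min (e s : ℕ) D = D).map
        (e.toEmbedding.trans Fin.valEmbedding) = Finset.Ico D (Fintype.card 𝒮) := by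
      ext k
      simp only [Finset.mem_map, Finset.mem_filter, Finset.mem_univ, true_and, Finset.mem_Ico,
        Function.Embedding.trans_apply, Equiv.coe_toEmbedding, Fin.valEmbedding_apply,
        min_eq_right_iff]
      constructor
      · rintro ⟨s, hs, rfl⟩
        exact ⟨hs, (e s).2⟩
      · rintro ⟨h1, h2⟩
        exact ⟨e.symm ⟨k, h2⟩, by simpa using h1, by simp⟩
    rw [← Finset.card_map, h1, Nat.card_Ico]

open Classical in
/-- The MDP with layers `0, …, D` that starts anywhere in layer `0`. A good action leads from a layer
below `D` anywhere into the next layer; in all other cases the state `s` is followed by `trap s`. -/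
noncomputable def layeredMDP (layer : 𝒮 → ℕ) (D H : ℕ) (hne : ∀ k ≤ D, ∃ s, layer s = k) (good : 𝒜 → Prop)
    (trap : 𝒮 → 𝒮) : MDP 𝒮 𝒜 where
  R := fun _ _ => 0
  μ₀ := PMF.uniformOfFinset (Finset.univ.filter fun s => layer s = 0)
    (by obtain ⟨s, hs⟩ := hne 0 (Nat.zero_le _); exact ⟨s, by simpa using hs⟩)
  P := fun s a => if h : layer s < D ∧ good a then
      PMF.uniformOfFinset (Finset.univ.filter fun s' => layer s' = layer s + 1)
        (by obtain ⟨s', hs⟩ := hne (layer s + 1) h.1; exact ⟨s', by simpa using hs⟩)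
    else PMF.pure (trap s)
  H := H

variable {layer : 𝒮 → ℕ} {D H : ℕ} {hne : ∀ k ≤ D, ∃ s, layer s = k} {good : 𝒜 → Prop}
  {trap : 𝒮 → 𝒮}

lemma layeredMDP_start_pos {s : 𝒮} :
    0 < (layeredMDP layer D H hne good trap).μ₀ s ↔ layer s = 0 := by
  rw [PMF.apply_pos_iff]
  simp [layeredMDP]

lemma layeredMDP_P_pos_of_good {s s' : 𝒮} {a : 𝒜} (h : layer s < D ∧ good a) :
    0 < (layeredMDP layer D H hne good trap).P s a s' ↔ layer s' = layer s + 1 := by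
  rw [PMF.apply_pos_iff]
  simp [layeredMDP, h]

lemma layeredMDP_P_pos_of_not_good {s s' : 𝒮} {a : 𝒜} (h : ¬ (layer s < D ∧ good a)) :
    0 < (layeredMDP layer D H hne good trap).P s a s' ↔ s' = trap s := by
  rw [PMF.apply_pos_iff]
  simp only [layeredMDP, dif_neg h, PMF.support_pure, Set.mem_singleton_iff]

/-- If the trap of a state is a fixed state `bin` or the state itself, then no state other than `bin`
can be reached faster than layer by layer, so the diameter is the number of the last layer. -/
lemma layeredMDP_mem_family (hle : ∀ s, layer s ≤ D) (hgood : ∃ a, good a) {bin l : 𝒮}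
    (htrap : ∀ s, trap s = bin ∨ trap s = s) (hbin : layer bin = D) (hl : layer l = D)
    (hlb : l ≠ bin) :
    layeredMDP layer D H hne good trap ∈ mdpFamily 𝒮 𝒜 H D := by
  obtain ⟨a₀, ha₀⟩ := hgood
  refine ⟨rfl, le_antisymm ?_ ?_⟩
  · have hreach : ∀ k s, layer s = k →
        (layeredMDP layer D H hne good trap).ReachIn k s := by
      intro k
      induction k with
      | zero => exact fun s hs => .init s (layeredMDP_start_pos.2 hs)
      | succ k ih =>
        intro s hs
        have hk : k < D := by have := hle s; omega
        obtain ⟨s₁, hs₁⟩ := hne k hk.le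
        exact .step k s₁ a₀ s (ih s₁ hs₁)
          ((layeredMDP_P_pos_of_good ⟨by omega, ha₀⟩).2 (by omega))
    refine iSup_le fun s => (iInf₂_le (layer s) (hreach _ s rfl)).trans ?_
    exact_mod_cast hle s
  · have hslow : ∀ n s, (layeredMDP layer D H hne good trap).ReachIn n s →
        s ≠ bin → layer s ≤ n := by
      intro n s h
      induction h with
      | init s hs => exact fun _ => (layeredMDP_start_pos.1 hs).le
      | step n s a s' _ hs ih =>
        intro hb
        by_cases hga : layer s < D ∧ good a
        · have h1 := (layeredMDP_P_pos_of_good hga).1 hs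
          by_cases hsb : s = bin
          · rw [hsb, hbin] at hga
            exact absurd hga.1 (lt_irrefl D)
          · have := ih hsb
            omega
        · have h1 := (layeredMDP_P_pos_of_not_good hga).1 hs
          rcases htrap s with h2 | h2
          · exact absurd (h1.trans h2) hb
          · rw [h2] at h1
            subst h1
            exact (ih hb).trans (Nat.le_succ n)
    refine le_iSup_of_le l (le_iInf₂ fun n hn => ?_)
    exact_mod_cast hl ▸ hslow n l hn hlb

end Layered

/-! ### Teaching last-layer states one action per episode -/

section OneActionPerEpisode

variable {𝒮 𝒜 : Type*} [Fintype 𝒜]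

open Classical in
/-- A lower bound for the expected number of visits to the state `l` that are still needed to make
`a₀` greedy there: half the number of its competitors that have never been taken in `l`, or zero
once `a₀` itself has been taken there. -/
noncomputable def stateWork (a₀ : 𝒜) (h : History 𝒮 𝒜) (l : 𝒮) : ℝ :=
  if Tried h l a₀ then 0 else ((Finset.univ.filter fun a => a ≠ a₀ ∧ ¬ Tried h l a).card : ℝ) / 2

lemma stateWork_nonneg (a₀ : 𝒜) (h : History 𝒮 𝒜) (l : 𝒮) : 0 ≤ stateWork a₀ h l := by
  unfold stateWork
  split_ifs <;> positivity

lemma stateWork_nil (a₀ : 𝒜) (l : 𝒮) :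
    stateWork a₀ ([] : History 𝒮 𝒜) l = ((Fintype.card 𝒜 : ℝ) - 1) / 2 := by
  classical
  rw [stateWork, if_neg not_tried_nil]
  simp only [not_tried_nil, not_false_eq_true, and_true]
  rw [Finset.filter_ne', Finset.card_erase_of_mem (Finset.mem_univ _), Finset.card_univ,
    Nat.cast_sub (Fintype.card_pos_iff.2 ⟨a₀⟩), Nat.cast_one]

lemma stateWork_cons_le (a₀ : 𝒜) (e : Experience 𝒮 𝒜) (h : History 𝒮 𝒜) (l : 𝒮) :
    stateWork a₀ (e :: h) l ≤ stateWork a₀ h l := by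
  classical
  by_cases h0 : Tried h l a₀
  · rw [stateWork, stateWork, if_pos h0, if_pos (tried_cons.2 (Or.inr h0))]
  · by_cases h1 : Tried (e :: h) l a₀
    · rw [stateWork, if_pos h1]
      exact stateWork_nonneg _ _ _
    · rw [stateWork, stateWork, if_neg h0, if_neg h1]
      have : (Finset.univ.filter fun a => a ≠ a₀ ∧ ¬ Tried (e :: h) l a).card ≤
          (Finset.univ.filter fun a => a ≠ a₀ ∧ ¬ Tried h l a).card := by
        refine Finset.card_le_card fun a => ?_
        simp only [Finset.mem_filter, Finset.mem_univ, true_and, tried_cons, not_or]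
        exact fun ha => ⟨ha.1, ha.2.2⟩
      have : ((Finset.univ.filter fun a => a ≠ a₀ ∧ ¬ Tried (e :: h) l a).card : ℝ) ≤
          (Finset.univ.filter fun a => a ≠ a₀ ∧ ¬ Tried h l a).card := by exact_mod_cast this
      linarith

lemma stateWork_le (a₀ : 𝒜) (h : History 𝒮 𝒜) (l : 𝒮) :
    stateWork a₀ h l ≤ ((Fintype.card 𝒜 : ℝ) - 1) / 2 := by
  induction h with
  | nil => exact (stateWork_nil a₀ l).le
  | cons e h ih => exact (stateWork_cons_le a₀ e h l).trans ih

lemma stateWork_cons_of_ne (a₀ : 𝒜) {e : Experience 𝒮 𝒜} (h : History 𝒮 𝒜) {l : 𝒮}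
    (hl : e.state ≠ l) : stateWork a₀ (e :: h) l = stateWork a₀ h l := by
  have h1 : Tried (e :: h) l = Tried h l := funext fun a => propext <| by
    rw [tried_cons, or_iff_right fun hh => hl hh.1]
  rw [stateWork, stateWork, h1]

open Classical in
lemma le_stateWork_cons (a₀ : 𝒜) (e : Experience 𝒮 𝒜) (h : History 𝒮 𝒜) (l : 𝒮) :
    stateWork a₀ h l - (if e.action = a₀ then stateWork a₀ h l else 1 / 2) ≤
      stateWork a₀ (e :: h) l := by
  by_cases ha : e.action = a₀
  · rw [if_pos ha, sub_self]
    exact stateWork_nonneg _ _ _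
  · rw [if_neg ha]
    by_cases h0 : Tried h l a₀
    · rw [stateWork, if_pos h0]
      linarith [stateWork_nonneg a₀ (e :: h) l]
    · have h1 : ¬ Tried (e :: h) l a₀ := by
        rw [tried_cons]
        tauto
      rw [stateWork, stateWork, if_neg h0, if_neg h1]
      have : (Finset.univ.filter fun a => a ≠ a₀ ∧ ¬ Tried h l a).card ≤
          (insert e.action (Finset.univ.filter fun a => a ≠ a₀ ∧ ¬ Tried (e :: h) l a)).card := by
        refine Finset.card_le_card fun a => ?_
        simp only [Finset.mem_insert, Finset.mem_filter, Finset.mem_univ, true_and, tried_cons]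
        tauto
      have := this.trans (Finset.card_insert_le _ _)
      have : ((Finset.univ.filter fun a => a ≠ a₀ ∧ ¬ Tried h l a).card : ℝ) ≤
          (Finset.univ.filter fun a => a ≠ a₀ ∧ ¬ Tried (e :: h) l a).card + 1 := by
        exact_mod_cast this
      linarith

/-- As long as there is work left at `l`, the action `a₀` is not greedy there. -/
lemma greedy_ne_of_stateWork_ne_zero (L : Learner 𝒮 𝒜) {a₀ : 𝒜} {h : History 𝒮 𝒜} {l : 𝒮}
    (hw : stateWork a₀ h l ≠ 0) : L.greedy (L.table (lastTable 𝒮 a₀) h) l ≠ a₀ := by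
  classical
  by_cases h0 : Tried h l a₀
  · rw [stateWork, if_pos h0] at hw
    exact absurd rfl hw
  · rw [stateWork, if_neg h0] at hw
    have hne : (Finset.univ.filter fun a => a ≠ a₀ ∧ ¬ Tried h l a).Nonempty := by
      rw [Finset.nonempty_iff_ne_empty]
      intro hemp
      rw [hemp] at hw
      simp at hw
    obtain ⟨b, hb⟩ := hne
    simp only [Finset.mem_filter, Finset.mem_univ, true_and] at hb
    exact L.greedy_ne_of_not_tried hb.1 h0 hb.2

open Classical in
/-- A single visit reduces the work at a state by at most one in expectation: exploration hits `a₀`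
with probability at most `1 / A`, and every other action reduces the work by at most `1 / 2`. -/
lemma expected_stateWork_decrease_le [Nontrivial 𝒜] (L : Learner 𝒮 𝒜)
    (hε : L.ε ≤ 1 - 1 / (Fintype.card 𝒜 : ℝ)) (a₀ : 𝒜) (h : History 𝒮 𝒜) (l : 𝒮) :
    ∑ a, (L.behavior (L.table (lastTable 𝒮 a₀) h) l a).toReal *
      (if a = a₀ then stateWork a₀ h l else 1 / 2) ≤ 1 := by
  set q : 𝒜 → ℝ := fun a => (L.behavior (L.table (lastTable 𝒮 a₀) h) l a).toReal with hq
  have hA := one_lt_card_real 𝒜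
  have hq0 : ∀ a, 0 ≤ q a := fun a => ENNReal.toReal_nonneg
  have hpt : ∀ a, q a * (if a = a₀ then stateWork a₀ h l else 1 / 2) ≤
      (if a = a₀ then q a * stateWork a₀ h l else 0) + q a * (1 / 2) := by
    intro a
    split_ifs
    · linarith [hq0 a]
    · linarith
  have h1 : q a₀ * stateWork a₀ h l ≤ 1 / 2 := by
    by_cases hw : stateWork a₀ h l = 0
    · rw [hw]
      norm_num
    · have h2 : q a₀ ≤ 1 / (Fintype.card 𝒜 : ℝ) :=
        (L.behavior_toReal_of_ne _ (greedy_ne_of_stateWork_ne_zero L hw)).trans_le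
          (L.exploration_le hε)
      calc q a₀ * stateWork a₀ h l
          ≤ 1 / (Fintype.card 𝒜 : ℝ) * (((Fintype.card 𝒜 : ℝ) - 1) / 2) :=
            mul_le_mul h2 (stateWork_le _ _ _) (stateWork_nonneg _ _ _) (by positivity)
        _ ≤ 1 / 2 := by
            rw [div_mul_div_comm, div_le_div_iff₀ (by positivity) (by norm_num)]
            linarith
  calc ∑ a, q a * (if a = a₀ then stateWork a₀ h l else 1 / 2)
      ≤ ∑ a, ((if a = a₀ then q a * stateWork a₀ h l else 0) + q a * (1 / 2)) :=
        Finset.sum_le_sum fun a _ => hpt a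
    _ = q a₀ * stateWork a₀ h l + 1 / 2 := by
        rw [Finset.sum_add_distrib, ← Finset.sum_mul, sum_toReal_eq_one]
        simp
    _ ≤ 1 := by linarith

variable [Fintype 𝒮] [Nontrivial 𝒜]

/-- If only the target action `a₀` advances along the layers, and everything else leads to an absorbing
state `bin`, then an episode reaches the last layer with probability at most `(1 - ε) ^ D`, and
allows a single action there. -/
lemma expectedLength_bin_ge (L : Learner 𝒮 𝒜) (hε : L.ε ≤ 1 - 1 / (Fintype.card 𝒜 : ℝ))
    {layer : 𝒮 → ℕ} {D H : ℕ} (hle : ∀ s, layer s ≤ D) {hne : ∀ k ≤ D, ∃ s, layer s = k}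
    (hH : 0 < H) (a₀ : 𝒜) {bin : 𝒮} (hbin : layer bin = D) {τ : Teacher 𝒮 𝒜}
    (hτ : τ.IsLevelThree (layeredMDP layer D H hne (· = a₀) fun _ => bin)) :
    ENNReal.ofReal (H / (1 - L.ε) ^ D *
      ((((Finset.univ.filter fun s => layer s = D).card : ℝ) - 1) *
        (((Fintype.card 𝒜 : ℝ) - 1) / 2)) - H) ≤
      expectedLength (layeredMDP layer D H hne (· = a₀) fun _ => bin) L (lastTable 𝒮 a₀)
        (fun _ => a₀) τ := by
  classical
  have hA := one_lt_card_real 𝒜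
  have hε1 : 0 < 1 - L.ε := by
    have : 0 < 1 / (Fintype.card 𝒜 : ℝ) := by positivity
    linarith
  set F := (Finset.univ.filter fun s => layer s = D).erase bin with hF
  have hFmem : ∀ {s}, s ∈ F ↔ s ≠ bin ∧ layer s = D := by simp [hF]
  have hFcard : (F.card : ℝ) = ((Finset.univ.filter fun s => layer s = D).card : ℝ) - 1 := by
    have hmem : bin ∈ Finset.univ.filter fun s => layer s = D := by simp [hbin]
    rw [hF, Finset.card_erase_of_mem hmem, Nat.cast_sub (Finset.card_pos.2 ⟨_, hmem⟩),
      Nat.cast_one]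
  have hW : ∀ e h, e.state ∉ F → ∑ l ∈ F, stateWork a₀ (e :: h) l = ∑ l ∈ F, stateWork a₀ h l :=
    fun e h he => Finset.sum_congr rfl fun l hl =>
      stateWork_cons_of_ne a₀ h (by rintro rfl; exact he hl)
  have hnil : ((((Finset.univ.filter fun s => layer s = D).card : ℝ) - 1) *
        (((Fintype.card 𝒜 : ℝ) - 1) / 2)) = ∑ l ∈ F, stateWork a₀ [] l := by
    simp_rw [stateWork_nil]
    rw [Finset.sum_const, nsmul_eq_mul, hFcard]
  rw [hnil]
  refine work_le_expectedLength hτ hH (W := fun h => ∑ l ∈ F, stateWork a₀ h l)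
    (g := fun _ s => if s = bin then 0 else (1 - L.ε) ^ (D - layer s))
    (C := ∑ l ∈ F, ((Fintype.card 𝒜 : ℝ) - 1) / 2) (pow_pos hε1 D)
    (fun h => Finset.sum_le_sum fun l _ => stateWork_le a₀ h l) ?_ ?_ ?_ ?_
  · intro h hl
    refine Finset.sum_eq_zero fun l _ => ?_
    by_contra hw
    exact greedy_ne_of_stateWork_ne_zero L hw (hl l)
  · intro h s
    split_ifs
    · exact le_rfl
    · exact (pow_pos hε1 _).le
  · intro h s hs
    rw [layeredMDP_start_pos] at hs
    simp only [hs, Nat.sub_zero]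
    split_ifs
    · exact (pow_pos hε1 _).le
    · exact le_rfl
  · intro h s
    set q : 𝒜 → ℝ := fun a => (L.behavior (L.table (lastTable 𝒮 a₀) h) s a).toReal with hq
    have hq1 : ∑ a, q a = 1 := sum_toReal_eq_one _
    set w := ∑ l ∈ F, stateWork a₀ h l with hw
    by_cases hsD : layer s < D
    · have hsF : s ∉ F := fun hs => hsD.ne (hFmem.1 hs).2
      have hsb : s ≠ bin := by
        rintro rfl
        exact hsD.ne hbin
      refine ⟨fun a => w - if a = a₀ then (1 - L.ε) ^ (D - layer s - 1) else 0, ?_, ?_⟩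
      · intro a r s' hs'
        rw [hW _ _ hsF]
        beta_reduce
        by_cases ha : a = a₀
        · have h1 := (layeredMDP_P_pos_of_good (good := (· = a₀)) ⟨hsD, ha⟩).1 hs'
          rw [if_pos ha, h1, Nat.sub_add_eq]
          refine sub_le_sub_left ?_ _
          split_ifs
          · exact (pow_pos hε1 _).le
          · exact le_rfl
        · have h1 := (layeredMDP_P_pos_of_not_good (good := (· = a₀)) fun hh => ha hh.2).1 hs'
          rw [if_neg ha, if_pos h1]
      · have h1 : ∑ a, q a * (w - if a = a₀ then (1 - L.ε) ^ (D - layer s - 1) else 0) =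
            w - q a₀ * (1 - L.ε) ^ (D - layer s - 1) := by
          simp_rw [mul_sub]
          rw [Finset.sum_sub_distrib, ← Finset.sum_mul, hq1]
          simp
        rw [h1]
        simp only [if_neg hsb]
        have h2 : (1 - L.ε) ^ (D - layer s) = (1 - L.ε) * (1 - L.ε) ^ (D - layer s - 1) := by
          rw [← pow_succ']
          congr 1
          omega
        rw [h2]
        exact sub_le_sub_left (mul_le_mul_of_nonneg_right (L.behavior_toReal_le hε _ _ _)
          (pow_pos hε1 _).le) _
    · have hsD' : layer s = D := le_antisymm (hle s) (not_lt.1 hsD)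
      have hnext : ∀ {a s'}, 0 < (layeredMDP layer D H hne (· = a₀) fun _ => bin).P s a s' →
          s' = bin := fun hs' => (layeredMDP_P_pos_of_not_good fun hh => hsD hh.1).1 hs'
      by_cases hsb : s = bin
      · refine ⟨fun _ => w, ?_, ?_⟩
        · intro a r s' hs'
          rw [hW _ _ (fun hs => (hFmem.1 hs).1 hsb), if_pos (hnext hs'), sub_zero]
        · rw [← Finset.sum_mul, hq1, one_mul]
          simp [hsb]
      · have hsF : s ∈ F := hFmem.2 ⟨hsb, hsD'⟩
        refine ⟨fun a => w - if a = a₀ then stateWork a₀ h s else 1 / 2, ?_, ?_⟩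
        · intro a r s' hs'
          rw [if_pos (hnext hs'), sub_zero, hw, ← Finset.add_sum_erase _ _ hsF,
            ← Finset.add_sum_erase _ _ hsF]
          have h1 := le_stateWork_cons a₀ (⟨s, a, r, s'⟩ : Experience 𝒮 𝒜) h s
          have h2 : ∑ l ∈ F.erase s, stateWork a₀ (⟨s, a, r, s'⟩ :: h) l =
              ∑ l ∈ F.erase s, stateWork a₀ h l := Finset.sum_congr rfl fun l hl =>
            stateWork_cons_of_ne a₀ h (Finset.ne_of_mem_erase hl).symm
          rw [h2]
          linarith
        · have h1 : ∑ a, q a * (w - if a = a₀ then stateWork a₀ h s else 1 / 2) =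
              w - ∑ a, q a * (if a = a₀ then stateWork a₀ h s else 1 / 2) := by
            simp_rw [mul_sub]
            rw [Finset.sum_sub_distrib, ← Finset.sum_mul, hq1, one_mul]
          rw [h1]
          simp only [if_neg hsb, hsD', Nat.sub_self, pow_zero]
          exact sub_le_sub_left (expected_stateWork_decrease_le L hε a₀ h s) _

end OneActionPerEpisode

/-! ### Teaching absorbing states one state per episode -/

section OneStatePerEpisode

variable {𝒮 𝒜 : Type*}

/-- The state `s` has been visited, and an action taken there, in the history `h`. -/
def Visited (h : History 𝒮 𝒜) (s : 𝒮) : Prop := ∃ e ∈ h, e.state = s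

lemma visited_cons {e : Experience 𝒮 𝒜} {h : History 𝒮 𝒜} {s : 𝒮} :
    Visited (e :: h) s ↔ e.state = s ∨ Visited h s := by
  simp [Visited]

variable [Fintype 𝒮] [Fintype 𝒜] [Nontrivial 𝒜]

/-- If all states of the last layer are absorbing, then an episode can teach only one of them. -/
lemma expectedLength_absorbing_ge (L : Learner 𝒮 𝒜) {layer : 𝒮 → ℕ} {D H : ℕ}
    {hne : ∀ k ≤ D, ∃ s, layer s = k} (hH : 0 < H) (a₀ : 𝒜)
    {τ : Teacher 𝒮 𝒜} (hτ : τ.IsLevelThree (layeredMDP layer D H hne (fun _ => True) id)) :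
    ENNReal.ofReal (H * (((Finset.univ.filter fun s => layer s = D).card : ℝ) - 1)) ≤
      expectedLength (layeredMDP layer D H hne (fun _ => True) id) L (lastTable 𝒮 a₀)
        (fun _ => a₀) τ := by
  classical
  set F := Finset.univ.filter fun s => layer s = D with hF
  have hFmem : ∀ {s}, s ∈ F ↔ layer s = D := by simp [hF]
  set W : History 𝒮 𝒜 → ℝ := fun h => ∑ l ∈ F, if Visited h l then 0 else 1 with hW
  have hnil : W [] = F.card := by simp [hW, Visited]
  have hsame : ∀ e h, (e.state ∈ F → Visited h e.state) → W (e :: h) = W h := by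
    intro e h he
    refine Finset.sum_congr rfl fun l hl => ?_
    have : Visited (e :: h) l ↔ Visited h l := by
      rw [visited_cons]
      refine or_iff_right_of_imp ?_
      rintro rfl
      exact he hl
    simp only [this]
  have hdec : ∀ e h, e.state ∈ F → ¬ Visited h e.state → W h - 1 = W (e :: h) := by
    intro e h he hv
    simp only [hW]
    rw [← Finset.add_sum_erase _ _ he, ← Finset.add_sum_erase (a := e.state) _ _ he, if_neg hv,
      if_pos (visited_cons.2 (Or.inl rfl))]
    have : ∑ l ∈ F.erase e.state, (if Visited (e :: h) l then (0 : ℝ) else 1) =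
        ∑ l ∈ F.erase e.state, if Visited h l then (0 : ℝ) else 1 := by
      refine Finset.sum_congr rfl fun l hl => ?_
      simp only [visited_cons, (Finset.ne_of_mem_erase hl).symm, false_or]
    rw [this]
    ring
  have hmain := work_le_expectedLength (L := L) (Q₀ := lastTable 𝒮 a₀) (target := fun _ => a₀)
    hτ hH W (fun h s => if layer s = D ∧ Visited h s then 0 else 1) (C := F.card) (ρ := 1)
    one_pos ?_ ?_ ?_ ?_ ?_
  · rw [hnil] at hmain
    refine le_trans (ENNReal.ofReal_le_ofReal (le_of_eq ?_)) hmain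
    change (H : ℝ) * (F.card - 1) = H / 1 * F.card - H
    ring
  · intro h
    rw [← mul_one (F.card : ℝ), ← nsmul_eq_mul, ← Finset.sum_const]
    refine Finset.sum_le_sum fun l _ => ?_
    split_ifs <;> norm_num
  · intro h hl
    refine Finset.sum_eq_zero fun l _ => if_pos ?_
    by_contra hv
    obtain ⟨b, hb⟩ := exists_ne a₀
    have hnt : ∀ a, ¬ Tried h l a := fun a ⟨e, he, hs⟩ => hv ⟨e, he, hs.1⟩
    exact L.greedy_ne_of_not_tried hb (hnt _) (hnt _) (hl l)
  · intro h s
    split_ifs <;> norm_num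
  · intro h s _
    split_ifs <;> norm_num
  · intro h s
    refine ⟨fun _ => W h - if layer s = D ∧ Visited h s then 0 else 1, ?_, ?_⟩
    · intro a r s' hs'
      by_cases hsD : layer s = D
      · rw [layeredMDP_P_pos_of_not_good (by simp [hsD]), id] at hs'
        subst hs'
        rw [if_pos (⟨hsD, visited_cons.2 (Or.inl rfl)⟩ :
          layer s' = D ∧ Visited (⟨s', a, r, s'⟩ :: h) s'), sub_zero]
        by_cases hv : Visited h s'
        · rw [if_pos ⟨hsD, hv⟩, sub_zero, hsame _ _ fun _ => hv]
        · rw [if_neg fun hh => hv hh.2]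
          exact (hdec ⟨s', a, r, s'⟩ h (hFmem.2 hsD) hv).le
      · rw [if_neg fun hh => hsD hh.1, hsame _ _ fun hs => absurd (hFmem.1 hs) hsD]
        refine sub_le_sub_left ?_ _
        split_ifs <;> norm_num
    · rw [← Finset.sum_mul, sum_toReal_eq_one, one_mul]

end OneStatePerEpisode

lemma le_teachingDim {𝒮 𝒜 : Type*} [Fintype 𝒜] [Nontrivial 𝒜] {L : Learner 𝒮 𝒜}
    {ℳ : Set (MDP 𝒮 𝒜)} {M : MDP 𝒮 𝒜} (hM : M ∈ ℳ) (Q₀ : QTable 𝒮 𝒜) (target : 𝒮 → 𝒜)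
    {c : ℝ≥0∞}
    (h : ∀ τ : Teacher 𝒮 𝒜, τ.IsLevelThree M → c ≤ expectedLength M L Q₀ target τ) :
    c ≤ teachingDim L ℳ :=
  (le_iInf₂ h).trans <| le_iSup_of_le target <| le_iSup_of_le Q₀ <| le_iSup₂_of_le M hM le_rfl

end TeachRL

theorem theorem3 :
    ∃ c : ℝ, 0 < c ∧
      ∀ (𝒮 𝒜 : Type*) [Fintype 𝒮] [Fintype 𝒜] [Nontrivial 𝒜] (L : TeachRL.Learner 𝒮 𝒜)
        (H D : ℕ), D ≤ H → D + 2 ≤ Fintype.card 𝒮 →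
        L.ε ≤ 1 - 1 / (Fintype.card 𝒜 : ℝ) →
        ENNReal.ofReal (c * (((Fintype.card 𝒮 : ℝ) - D) * Fintype.card 𝒜 * H *
            (1 / (1 - L.ε)) ^ D))
          ≤ TeachRL.teachingDim L (TeachRL.mdpFamily 𝒮 𝒜 H D) := by
  classical
  refine ⟨1 / 16, by norm_num, ?_⟩
  intro 𝒮 𝒜 _ _ _ L H D _ hS hε
  rcases Nat.eq_zero_or_pos H with rfl | hH
  · simp
  obtain ⟨layer, hle, hne, hcard⟩ := TeachRL.exists_layer (𝒮 := 𝒮) (D := D) (by omega)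
  obtain ⟨l, hl, bin, hbin, hlb⟩ := Finset.one_lt_card.1
    (show 1 < (Finset.univ.filter fun s => layer s = D).card by omega)
  simp only [Finset.mem_filter, Finset.mem_univ, true_and] at hl hbin
  obtain ⟨a₀, -⟩ := exists_pair_ne 𝒜
  have hA : (2 : ℝ) ≤ Fintype.card 𝒜 := by exact_mod_cast Fintype.one_lt_card (α := 𝒜)
  have hn : ((Finset.univ.filter fun s => layer s = D).card : ℝ) = (Fintype.card 𝒮 : ℝ) - D := by
    rw [hcard, Nat.cast_sub (by omega)]
  have hS' : (2 : ℝ) ≤ (Fintype.card 𝒮 : ℝ) - D := by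
    have : ((D + 2 : ℕ) : ℝ) ≤ Fintype.card 𝒮 := by exact_mod_cast hS
    push_cast at this
    linarith
  have hε1 : 0 < 1 - L.ε := by
    have : 0 < 1 / (Fintype.card 𝒜 : ℝ) := by positivity
    linarith
  have hρ : 0 < (1 - L.ε) ^ D := pow_pos hε1 D
  rw [one_div (1 - L.ε), inv_pow]
  have hH0 : (0 : ℝ) ≤ H := Nat.cast_nonneg H
  have h1 := fun τ hτ => TeachRL.expectedLength_bin_ge L hε hle (hne := hne) hH a₀ hbin (τ := τ) hτ
  have h2 := fun τ hτ => TeachRL.expectedLength_absorbing_ge L (hne := hne) hH a₀ (τ := τ) hτ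
  rw [hn] at h1 h2
  generalize (Fintype.card 𝒮 : ℝ) - D = n at h1 h2 hS' ⊢
  generalize (Fintype.card 𝒜 : ℝ) = A at h1 hA ⊢
  generalize (1 - L.ε) ^ D = ρ at h1 hρ ⊢
  have hnA : n * A ≤ 4 * ((n - 1) * (A - 1)) := by nlinarith
  have hHρ : 0 ≤ (H : ℝ) / ρ := by positivity
  -- The first bound loses one episode of length `H`, which matters only if less than two
  -- episodes are needed; the second bound then suffices.
  rcases le_total (2 * ρ) ((n - 1) * ((A - 1) / 2)) with hc | hc
  · refine TeachRL.le_teachingDim (TeachRL.layeredMDP_mem_family (good := (· = a₀)) (trap := fun _ => bin)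
      hle ⟨a₀, rfl⟩ (fun _ => Or.inl rfl) hbin hl hlb) (TeachRL.lastTable 𝒮 a₀) (fun _ => a₀)
      fun τ hτ => le_trans (ENNReal.ofReal_le_ofReal ?_) (h1 τ hτ)
    have h3 := mul_le_mul_of_nonneg_left hc hHρ
    have h4 : (H : ℝ) / ρ * (2 * ρ) = 2 * H := by field_simp
    have h5 := mul_le_mul_of_nonneg_left hnA hHρ
    have h6 : 1 / 16 * (n * A * H * ρ⁻¹) = 1 / 16 * (H / ρ * (n * A)) := by
      rw [div_eq_mul_inv (H : ℝ)]
      ring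
    rw [h6]
    linarith
  · refine TeachRL.le_teachingDim (TeachRL.layeredMDP_mem_family (good := fun _ => True) (trap := id)
      hle ⟨a₀, trivial⟩ (fun _ => Or.inr rfl) hbin hl hlb) (TeachRL.lastTable 𝒮 a₀) (fun _ => a₀)
      fun τ hτ => le_trans (ENNReal.ofReal_le_ofReal ?_) (h2 τ hτ)
    have h3 : n * A * ρ⁻¹ ≤ 16 := by
      rw [← div_eq_mul_inv, div_le_iff₀ hρ]
      linarith
    have h4 := mul_le_mul_of_nonneg_left h3 hH0
    have h5 := mul_le_mul_of_nonneg_left (show 1 ≤ n - 1 by linarith) hH0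
    linarith
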